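/- Let $n\ge 1$ and $d\ge 2$. On a qudit with computational basis $|j\rangle$, $j\in\mathbb Z_d$, let $X|j\rangle=|j+1\rangle$ and $Z|j\rangle=e^{2\pi i j/d}|j\rangle$, and for $a=(a_1,\dots,a_n)$ with $a_i=(s_i,t_i)\in\mathbb Z_d\times\mathbb Z_d$ let $P_a=\bigotimes_{i=1}^n X^{s_i}Z^{t_i}$ be the corresponding $n$-qudit Pauli operator and $|a|=\#\{i: a_i\ne(0,0)\}$ its weight. For $n$-qudit operators let $\langle O_1,O_2\rangle=d^{-n}\operatorname{tr}(O_1^\dagger O_2)$ and $\|O\|_2=\sqrt{\langle O,O\rangle}$. The average Pauli weight of $O=\sum_a c_aP_a$ (so $c_a=\langle P_a,O\rangle$) is $W(O)=\sum_a|a|\,|c_a|^2$. The Pauli growth of an $n$-qudit unitary $U$ is $$G(U)=\max\{\,W(U^\dagger OU)-1 \;:\; \|O\|_2=1,\ W(O)=1,\ \operatorname{tr}O=0\,\}.$$ A unitary $U$ is called non-entangling if $W(U^\dagger P_aU)=1$ for every Pauli operator $P_a$ with $|a|=1$. Then: 1. The maximum defining $G(U)$ is attained, and $G(U)\ge 0$,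 for every $n$-qudit unitary $U$. 2. For every unitary $U$, $G(U)=0$ if and only if $U$ is non-entangling; and $U$ is non-entangling if and only if it is a finite product of swap gates (exchanging two qudits) and single-qudit unitaries. 3. $G(U_1VU_2)=G(V)$ for every unitary $V$ and all non-entangling unitaries $U_1,U_2$. -/

import Mathlib

noncomputable section

namespace Qudit

/-- Computational basis labels of `n` qudits of local dimension `d`. -/
abbrev Config (n d : ℕ) : Type := Fin n → ZMod d

/-- Operators on `n` qudits of local dimension `d`, as matrices in the computational basis. -/
abbrev Op (n d : ℕ) : Type := Matrix (Config n d) (Config n d) ℂ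

/-- The label set `(ℤ_d × ℤ_d)^n` of the generalized Pauli operators. -/
abbrev PauliLabel (n d : ℕ) : Type := Fin n → ZMod d × ZMod d

/-- The generalized Pauli `X`: `X |j⟩ = |j + 1 mod d⟩`. -/
def pauliX (d : ℕ) : Matrix (ZMod d) (ZMod d) ℂ :=
  Matrix.of fun i j => if i = j + 1 then 1 else 0

/-- The generalized Pauli `Z`: `Z |j⟩ = exp (2 π i j / d) |j⟩`. -/
def pauliZ (d : ℕ) : Matrix (ZMod d) (ZMod d) ℂ :=
  Matrix.diagonal fun j => Complex.exp (2 * Real.pi * Complex.I * (j.val : ℂ) / (d : ℂ))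

/-- The tensor product `A 0 ⊗ ⋯ ⊗ A (n-1)` of single-qudit operators. -/
def tensor {n d : ℕ} (A : Fin n → Matrix (ZMod d) (ZMod d) ℂ) : Op n d :=
  Matrix.of fun x y => ∏ i, A i (x i) (y i)

section

variable {n d : ℕ} [NeZero d]

/-- The generalized Pauli operator `P_a = ⊗ᵢ X ^ sᵢ Z ^ tᵢ`, where `aᵢ = (sᵢ, tᵢ)`. -/
def pauli (a : PauliLabel n d) : Op n d :=
  tensor fun i => pauliX d ^ (a i).1.val * pauliZ d ^ (a i).2.val

/-- The Pauli weight `|a|`: the number of sites on which `a` is not `(0, 0)`. -/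
def labelWeight (a : PauliLabel n d) : ℕ :=
  (Finset.univ.filter fun i => a i ≠ (0, 0)).card

/-- The normalized Hilbert-Schmidt inner product `⟨O₁, O₂⟩ = tr (O₁† O₂) / d ^ n`. -/
def hsInner (O₁ O₂ : Op n d) : ℂ :=
  (O₁.conjTranspose * O₂).trace / (d : ℂ) ^ n

/-- The norm induced by `hsInner`. -/
def hsNorm (O : Op n d) : ℝ :=
  Real.sqrt (hsInner O O).re

/-- The coefficient `c_a` of `O = ∑ₐ c_a P_a` in the (orthonormal) Pauli basis. -/
def pauliCoeff (O : Op n d) (a : PauliLabel n d) : ℂ :=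
  hsInner (pauli a) O

/-- The average Pauli weight `W(O) = ∑ₐ |a| |c_a|²`. -/
def avgWeight (O : Op n d) : ℝ :=
  ∑ a : PauliLabel n d, (labelWeight a : ℝ) * ‖pauliCoeff O a‖ ^ 2

/-- Unitary operators on `n` qudits. -/
abbrev Unitary (n d : ℕ) [NeZero d] : Type := Matrix.unitaryGroup (Config n d) ℂ

/-- The Heisenberg evolution `U† O U`. -/
def evolve (U : Unitary n d) (O : Op n d) : Op n d :=
  (U : Op n d).conjTranspose * O * (U : Op n d)

/-- The values `W(U† O U) - 1`, as `O` runs over the traceless operators with `‖O‖₂ = 1`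
and `W(O) = 1`. -/
def growthValues (U : Unitary n d) : Set ℝ :=
  {g | ∃ O : Op n d, hsNorm O = 1 ∧ avgWeight O = 1 ∧ O.trace = 0 ∧
    g = avgWeight (evolve U O) - 1}

/-- The Pauli growth `G(U)`. -/
def pauliGrowth (U : Unitary n d) : ℝ :=
  sSup (growthValues U)

/-- `U` is non-entangling: conjugation by `U` maps every weight-1 Pauli operator to an operator
of average Pauli weight 1. -/
def IsNonEntangling (U : Unitary n d) : Prop :=
  ∀ a : PauliLabel n d, labelWeight a = 1 → avgWeight (evolve U (pauli a)) = 1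

/-- The swap gate of the sites `i` and `j`: `|y⟩ ↦ |y ∘ (i j)⟩`. -/
def swapGate (i j : Fin n) : Op n d :=
  Matrix.of fun x y => if x = y ∘ Equiv.swap i j then 1 else 0

/-- The operator that acts as `u` on site `i` and as the identity on all other sites. -/
def onSite (i : Fin n) (u : Matrix (ZMod d) (ZMod d) ℂ) : Op n d :=
  tensor (Function.update (fun _ => 1) i u)

/-- The group generated by the swap gates and the single-qudit unitaries. -/
def localSwapGroup (n d : ℕ) [NeZero d] : Subgroup (Unitary n d) :=
  Subgroup.closure
    ({U | ∃ i j : Fin n, (U : Op n d) = swapGate i j} ∪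
      {U | ∃ i : Fin n, ∃ u ∈ Matrix.unitaryGroup (ZMod d) ℂ, (U : Op n d) = onSite i u})

end

end Qudit

end

/-! Everything is read off the orthonormal Pauli expansion. For a traceless `O` of norm one, `W(O) -
1 = ∑ (|a| - 1) |c_a|²` has nonnegative terms, so `W(O) ≥ 1`, with equality exactly when only
weight-one labels occur (`avgWeight_eq_one_iff`). The equality case is a linear condition. Hence
non-entangling, which is tested on Paulis only, extends to all weight-one operators, and this gives
`G(U) = 0` iff `U` is non-entangling. The maximum exists because the feasible set is compact in
coefficient space and nonempty.

Swaps and single-site unitaries preserve `W` because they permute the one-site algebras, and `W` can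
be written through these algebras alone: being trivial on a site means commuting with its algebra
(`forall_commute_onSite_iff`, `avgWeight_eq_sum_sites`).

Conversely, let `U` be non-entangling and `M` a traceless operator on one site. Its image `A` has
weight one, and so does that of the traceless part of `M²`, so `A²` has no weight-two coefficient.
Those coefficients are twice the products of coefficients of `A` on distinct sites, so `A` lives on
a single site (`IsNonEntangling.pauliCoeff_evolve_mul_eq_zero`). By linearity the site does not
depend on `M`, so `U` permutes the one-site algebras. On each it acts by a star endomorphism, which
is conjugation by a unitary (`exists_unitary_mul_eq`). Undoing the permutation and these unitaries
leaves a unitary commuting with every one-site operator, hence a scalar. -/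

noncomputable section

namespace Qudit

open Matrix

/-! ### Single-site Pauli operators -/

section Site

variable {d : ℕ} [NeZero d]

/-- The single-site Pauli operator `X ^ s * Z ^ t`. -/
def sitePauli (p : ZMod d × ZMod d) : Matrix (ZMod d) (ZMod d) ℂ :=
  pauliX d ^ p.1.val * pauliZ d ^ p.2.val

theorem pauliX_pow_apply (k : ℕ) (x y : ZMod d) :
    (pauliX d ^ k) x y = if x = y + k then 1 else 0 := by
  induction k generalizing x y with
  | zero => simp [Matrix.one_apply]
  | succ k ih =>
    rw [pow_succ, Matrix.mul_apply]
    simp only [ih]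
    simp only [pauliX, Matrix.of_apply, mul_ite, mul_one, mul_zero, Finset.sum_ite_eq',
      Finset.mem_univ, if_true]
    push_cast
    congr 1
    rw [add_assoc, add_comm 1 (k : ZMod d)]

theorem pauliZ_eq_diagonal :
    pauliZ d = Matrix.diagonal fun j : ZMod d => ZMod.stdAddChar j := by
  unfold pauliZ
  congr 1
  funext j
  have h := ZMod.stdAddChar_coe (N := d) (j.val : ℤ)
  rw [Int.cast_natCast, Int.cast_natCast, ZMod.natCast_zmod_val] at h
  exact h.symm

theorem pauliZ_pow (t : ZMod d) :
    pauliZ d ^ t.val = Matrix.diagonal fun j : ZMod d => ZMod.stdAddChar (j * t) := by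
  rw [pauliZ_eq_diagonal, Matrix.diagonal_pow]
  congr 1
  funext j
  rw [Pi.pow_apply, ← AddChar.map_nsmul_eq_pow, nsmul_eq_mul, ZMod.natCast_val, ZMod.cast_id', id,
    mul_comm]

theorem sitePauli_apply (p : ZMod d × ZMod d) (x y : ZMod d) :
    sitePauli p x y = if x = y + p.1 then ZMod.stdAddChar (y * p.2) else 0 := by
  rw [sitePauli, pauliZ_pow, Matrix.mul_diagonal, pauliX_pow_apply, ZMod.natCast_val,
    ZMod.cast_id', id]
  split_ifs <;> simp

theorem sitePauli_zero : sitePauli (0 : ZMod d × ZMod d) = 1 := by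
  ext x y
  simp [sitePauli_apply, Matrix.one_apply]

theorem sitePauli_mul (p q : ZMod d × ZMod d) :
    sitePauli p * sitePauli q =
      (ZMod.stdAddChar (p.2 * q.1) : ℂ) • sitePauli (p + q) := by
  ext x y
  rw [Matrix.mul_apply, Matrix.smul_apply, smul_eq_mul]
  simp only [sitePauli_apply, mul_ite, mul_zero, Finset.sum_ite_eq', Finset.mem_univ,
    if_true, ite_mul, zero_mul]
  simp only [Prod.fst_add, Prod.snd_add]
  rw [add_assoc, add_comm q.1 p.1]
  split_ifs
  · rw [← AddChar.map_add_eq_mul, ← AddChar.map_add_eq_mul]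
    congr 1
    ring
  · rfl

theorem star_stdAddChar (x : ZMod d) :
    star (ZMod.stdAddChar x : ℂ) = ZMod.stdAddChar (-x) := by
  rw [AddChar.map_neg_eq_conj]
  rfl

/-- Different shifts leave no diagonal entry; equal shifts leave a character sum, which vanishes
unless the phases agree too. -/
theorem trace_sitePauli_conjTranspose_mul (p q : ZMod d × ZMod d) :
    ((sitePauli p)ᴴ * sitePauli q).trace = if p = q then (d : ℂ) else 0 := by
  have h : ((sitePauli p)ᴴ * sitePauli q).trace =
      ∑ y : ZMod d, if p.1 = q.1 then (ZMod.stdAddChar (y * (q.2 - p.2)) : ℂ) else 0 := by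
    rw [Matrix.trace]
    refine Finset.sum_congr rfl fun y _ => ?_
    rw [Matrix.diag_apply, Matrix.mul_apply]
    simp only [Matrix.conjTranspose_apply, sitePauli_apply]
    simp only [mul_ite, mul_zero, Finset.sum_ite_eq', Finset.mem_univ, if_true,
      add_right_inj]
    by_cases hpq : p.1 = q.1
    · simp only [hpq, if_true, star_stdAddChar]
      rw [← AddChar.map_add_eq_mul]
      congr 1
      ring
    · simp [hpq, Ne.symm hpq]
  rw [h]
  by_cases h1 : p.1 = q.1
  · simp only [h1, if_true]
    rw [AddChar.sum_mulShift _ (ZMod.isPrimitive_stdAddChar d), ZMod.card]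
    by_cases h2 : p.2 = q.2
    · simp [h2, Prod.ext_iff, h1]
    · simp [sub_eq_zero, Prod.ext_iff, h2, Ne.symm h2]
  · simp [h1, Prod.ext_iff]

end Site

/-! ### Tensor products of single-site operators -/

section Tensor

variable {n d : ℕ}

theorem tensor_apply (A : Fin n → Matrix (ZMod d) (ZMod d) ℂ) (x y : Config n d) :
    tensor A x y = ∏ i, A i (x i) (y i) := rfl

theorem tensor_mul [NeZero d] (A B : Fin n → Matrix (ZMod d) (ZMod d) ℂ) :
    tensor A * tensor B = tensor fun i => A i * B i := by
  ext x y
  simp only [Matrix.mul_apply, tensor_apply, Finset.prod_univ_sum, Fintype.piFinset_univ,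
    Finset.prod_mul_distrib]

theorem tensor_one : tensor (fun _ : Fin n => (1 : Matrix (ZMod d) (ZMod d) ℂ)) = 1 := by
  ext x y
  simp only [tensor_apply, Matrix.one_apply, Finset.prod_ite_zero, Finset.mem_univ, true_imp_iff,
    Finset.prod_const_one, funext_iff]

theorem conjTranspose_tensor (A : Fin n → Matrix (ZMod d) (ZMod d) ℂ) :
    (tensor A)ᴴ = tensor fun i => (A i)ᴴ := by
  ext x y
  simp [tensor_apply, Matrix.conjTranspose_apply]

theorem trace_tensor [NeZero d] (A : Fin n → Matrix (ZMod d) (ZMod d) ℂ) :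
    (tensor A).trace = ∏ i, (A i).trace := by
  simp only [Matrix.trace, Matrix.diag_apply, tensor_apply, Finset.prod_univ_sum,
    Fintype.piFinset_univ]

theorem tensor_smul (c : Fin n → ℂ) (A : Fin n → Matrix (ZMod d) (ZMod d) ℂ) :
    tensor (fun i => c i • A i) = (∏ i, c i) • tensor A := by
  ext x y
  simp [tensor_apply, Finset.prod_mul_distrib]

theorem tensor_update_apply (A : Fin n → Matrix (ZMod d) (ZMod d) ℂ) (i : Fin n)
    (u : Matrix (ZMod d) (ZMod d) ℂ) (x y : Config n d) :
    tensor (Function.update A i u) x y =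
      u (x i) (y i) * ∏ j ∈ Finset.univ.erase i, A j (x j) (y j) := by
  rw [tensor_apply, ← Finset.mul_prod_erase _ _ (Finset.mem_univ i), Function.update_self]
  congr 1
  refine Finset.prod_congr rfl fun j hj => ?_
  rw [Function.update_of_ne (Finset.ne_of_mem_erase hj)]

end Tensor

/-! ### Operators acting on one site -/

section OnSite

variable {n d : ℕ}

theorem onSite_one (i : Fin n) : onSite i (1 : Matrix (ZMod d) (ZMod d) ℂ) = 1 := by
  rw [onSite, Function.update_eq_self_iff.2 rfl, tensor_one]

theorem onSite_add (i : Fin n) (u v : Matrix (ZMod d) (ZMod d) ℂ) :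
    onSite i (u + v) = onSite i u + onSite i v := by
  ext x y
  simp [onSite, tensor_update_apply, add_mul]

theorem onSite_smul (i : Fin n) (c : ℂ) (u : Matrix (ZMod d) (ZMod d) ℂ) :
    onSite i (c • u) = c • onSite i u := by
  ext x y
  simp [onSite, tensor_update_apply, mul_assoc]

theorem onSite_mul [NeZero d] (i : Fin n) (u v : Matrix (ZMod d) (ZMod d) ℂ) :
    onSite i (u * v) = onSite i u * onSite i v := by
  rw [onSite, onSite, onSite, tensor_mul]
  congr 1
  funext j
  by_cases h : j = i
  · subst h; simp
  · simp [h]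

theorem conjTranspose_onSite (i : Fin n) (u : Matrix (ZMod d) (ZMod d) ℂ) :
    (onSite i u)ᴴ = onSite i uᴴ := by
  rw [onSite, onSite, conjTranspose_tensor]
  congr 1
  funext j
  by_cases h : j = i
  · subst h; simp
  · simp [h]

theorem onSite_injective (i : Fin n) :
    Function.Injective (onSite i : Matrix (ZMod d) (ZMod d) ℂ → Op n d) := by
  intro u v h
  ext a b
  -- The two configurations agree off site `i`, so all other tensor factors contribute 1.
  have := congrFun (congrFun h (Function.update 0 i a)) (Function.update 0 i b)
  rw [onSite, onSite, tensor_update_apply, tensor_update_apply, Function.update_self,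
    Function.update_self] at this
  have h1 : ∏ j ∈ Finset.univ.erase i, (1 : Matrix (ZMod d) (ZMod d) ℂ)
      (Function.update (0 : Config n d) i a j) (Function.update (0 : Config n d) i b j) = 1 := by
    refine Finset.prod_eq_one fun j hj => ?_
    rw [Function.update_of_ne (Finset.ne_of_mem_erase hj),
      Function.update_of_ne (Finset.ne_of_mem_erase hj)]
    simp
  rwa [h1, mul_one, mul_one] at this

theorem onSite_commute_tensor [NeZero d] (i : Fin n) (u : Matrix (ZMod d) (ZMod d) ℂ)
    (A : Fin n → Matrix (ZMod d) (ZMod d) ℂ) (h : Commute u (A i)) :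
    Commute (onSite i u) (tensor A) := by
  rw [commute_iff_eq, onSite, tensor_mul, tensor_mul]
  congr 1
  funext j
  by_cases hj : j = i
  · subst hj; simpa using h.eq
  · simp [hj]

theorem onSite_commute [NeZero d] {i j : Fin n} (hij : i ≠ j)
    (u v : Matrix (ZMod d) (ZMod d) ℂ) : Commute (onSite i u) (onSite j v) := by
  refine onSite_commute_tensor i u _ ?_
  rw [Function.update_of_ne hij]
  exact Commute.one_right u

/-- The embedding of single-site operators at a given site, as a star algebra homomorphism. -/
def onSiteHom [NeZero d] (i : Fin n) : Matrix (ZMod d) (ZMod d) ℂ →⋆ₐ[ℂ] Op n d where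
  toFun := onSite i
  map_one' := onSite_one i
  map_mul' := onSite_mul i
  map_zero' := by simpa using onSite_smul (n := n) i 0 (1 : Matrix (ZMod d) (ZMod d) ℂ)
  map_add' := onSite_add i
  commutes' c := by rw [Algebra.algebraMap_eq_smul_one, onSite_smul, onSite_one,
    Algebra.algebraMap_eq_smul_one]
  map_star' u := (conjTranspose_onSite i u).symm

theorem onSiteHom_apply [NeZero d] (i : Fin n) (u : Matrix (ZMod d) (ZMod d) ℂ) :
    onSiteHom i u = onSite i u := rfl

end OnSite

/-! ### The Pauli basis -/

section Basis

variable {n d : ℕ} [NeZero d]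

theorem pauli_eq_tensor (a : PauliLabel n d) : pauli a = tensor fun i => sitePauli (a i) := rfl

theorem pauli_zero : pauli (0 : PauliLabel n d) = 1 := by
  simp only [pauli_eq_tensor, Pi.zero_apply, sitePauli_zero, tensor_one]

theorem pauli_single (i : Fin n) (p : ZMod d × ZMod d) :
    pauli (Pi.single i p) = onSite i (sitePauli p) := by
  rw [pauli_eq_tensor, onSite]
  congr 1
  funext j
  by_cases h : j = i
  · subst h; simp
  · simp [h, sitePauli_zero]

/-- The scalar in `P_a * P_b = pauliPhase a b • P_{a + b}`. -/
def pauliPhase (a b : PauliLabel n d) : ℂ :=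
  ∏ i, (ZMod.stdAddChar ((a i).2 * (b i).1) : ℂ)

theorem pauli_mul (a b : PauliLabel n d) :
    pauli a * pauli b = pauliPhase a b • pauli (a + b) := by
  simp only [pauli_eq_tensor, tensor_mul, sitePauli_mul, pauliPhase, tensor_smul, Pi.add_apply]

theorem pauliPhase_of_disjoint {a b : PauliLabel n d} (h : ∀ i, a i = 0 ∨ b i = 0) :
    pauliPhase a b = 1 := by
  refine Finset.prod_eq_one fun i _ => ?_
  rcases h i with h | h <;> simp [h]

theorem pauliPhase_single_left (i : Fin n) (p : ZMod d × ZMod d) (a : PauliLabel n d) :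
    pauliPhase (Pi.single i p) a = ZMod.stdAddChar (p.2 * (a i).1) := by
  rw [pauliPhase, Finset.prod_eq_single i]
  · simp
  · intro j _ hj
    simp [hj]
  · simp

theorem pauliPhase_single_right (i : Fin n) (p : ZMod d × ZMod d) (a : PauliLabel n d) :
    pauliPhase a (Pi.single i p) = ZMod.stdAddChar ((a i).2 * p.1) := by
  rw [pauliPhase, Finset.prod_eq_single i]
  · simp
  · intro j _ hj
    simp [hj]
  · simp

theorem hsInner_pauli (a b : PauliLabel n d) :
    hsInner (pauli a) (pauli b) = if a = b then 1 else 0 := by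
  have hd : (d : ℂ) ^ n ≠ 0 := pow_ne_zero _ (Nat.cast_ne_zero.2 (NeZero.ne d))
  simp only [hsInner, pauli_eq_tensor, conjTranspose_tensor, tensor_mul, trace_tensor,
    trace_sitePauli_conjTranspose_mul, Finset.prod_ite_zero, Finset.mem_univ, true_imp_iff,
    Finset.prod_const, Finset.card_univ, Fintype.card_fin, funext_iff]
  split_ifs
  · exact div_self hd
  · exact zero_div _

theorem hsInner_add_right (A B C : Op n d) : hsInner A (B + C) = hsInner A B + hsInner A C := by
  simp [hsInner, mul_add, add_div]

theorem hsInner_smul_right (c : ℂ) (A B : Op n d) : hsInner A (c • B) = c * hsInner A B := by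
  simp [hsInner, mul_div_assoc]

theorem star_hsInner (A B : Op n d) : star (hsInner A B) = hsInner B A := by
  rw [hsInner, hsInner, star_div₀, star_pow, ← Matrix.trace_conjTranspose,
    Matrix.conjTranspose_mul, Matrix.conjTranspose_conjTranspose]
  simp

/-- The Pauli coefficient `c_a` as a linear functional. -/
def pauliCoeffHom (a : PauliLabel n d) : Op n d →ₗ[ℂ] ℂ where
  toFun O := pauliCoeff O a
  map_add' := hsInner_add_right _
  map_smul' c := hsInner_smul_right c _

theorem pauliCoeff_add (A B : Op n d) (a : PauliLabel n d) :
    pauliCoeff (A + B) a = pauliCoeff A a + pauliCoeff B a := hsInner_add_right _ _ _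

theorem pauliCoeff_smul (c : ℂ) (A : Op n d) (a : PauliLabel n d) :
    pauliCoeff (c • A) a = c * pauliCoeff A a := hsInner_smul_right _ _ _

theorem pauliCoeff_pauli (a b : PauliLabel n d) :
    pauliCoeff (pauli b) a = if a = b then 1 else 0 := hsInner_pauli a b

theorem pauliCoeff_sum {ι : Type*} (s : Finset ι) (f : ι → Op n d) (a : PauliLabel n d) :
    pauliCoeff (∑ i ∈ s, f i) a = ∑ i ∈ s, pauliCoeff (f i) a :=
  map_sum (pauliCoeffHom a) f s

theorem pauliCoeff_sum_smul_pauli (c : PauliLabel n d → ℂ) (a : PauliLabel n d) :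
    pauliCoeff (∑ b, c b • pauli b) a = c a := by
  simp [pauliCoeff_sum, pauliCoeff_smul, pauliCoeff_pauli]

theorem linearIndependent_pauli :
    LinearIndependent ℂ (pauli : PauliLabel n d → Op n d) := by
  rw [Fintype.linearIndependent_iff]
  intro c hc a
  rw [← pauliCoeff_sum_smul_pauli c a, hc]
  exact map_zero (pauliCoeffHom a)

/-- There are `d ^ (2 * n)` Paulis, as many as the dimension, so independence makes them span. -/
theorem sum_pauliCoeff_smul_pauli (O : Op n d) : ∑ a, pauliCoeff O a • pauli a = O := by
  have hspan := linearIndependent_pauli (n := n) (d := d).span_eq_top_of_card_eq_finrank' (by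
    simp only [Module.finrank_matrix, Module.finrank_self, Fintype.card_pi, Fintype.card_prod,
      ZMod.card, Finset.prod_const, Finset.card_univ, Fintype.card_fin, mul_one, mul_pow])
  have hO : O ∈ Submodule.span ℂ (Set.range (pauli : PauliLabel n d → Op n d)) := by
    rw [hspan]; trivial
  obtain ⟨c, rfl⟩ := (Submodule.mem_span_range_iff_exists_fun ℂ).1 hO
  simp only [pauliCoeff_sum_smul_pauli]

theorem ext_pauliCoeff {A B : Op n d} (h : ∀ a, pauliCoeff A a = pauliCoeff B a) : A = B := by
  rw [← sum_pauliCoeff_smul_pauli A, ← sum_pauliCoeff_smul_pauli B]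
  simp only [h]

theorem hsInner_eq_sum (A B : Op n d) :
    hsInner A B = ∑ a, star (pauliCoeff A a) * pauliCoeff B a := by
  have h : hsInner A B = ∑ a, pauliCoeff B a * hsInner A (pauli a) := by
    conv_lhs => rw [← sum_pauliCoeff_smul_pauli B]
    let f : Op n d →ₗ[ℂ] ℂ :=
      { toFun := hsInner A, map_add' := hsInner_add_right A, map_smul' := fun c => hsInner_smul_right c A }
    change f _ = _
    rw [map_sum]
    exact Finset.sum_congr rfl fun a _ => hsInner_smul_right _ _ _
  rw [h]
  refine Finset.sum_congr rfl fun a _ => ?_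
  rw [pauliCoeff, pauliCoeff, star_hsInner, mul_comm]

theorem hsInner_self (O : Op n d) : hsInner O O = ((∑ a, ‖pauliCoeff O a‖ ^ 2 : ℝ) : ℂ) := by
  rw [hsInner_eq_sum]
  push_cast
  exact Finset.sum_congr rfl fun a _ => Complex.conj_mul' _

theorem sum_norm_sq_pauliCoeff (O : Op n d) : ∑ a, ‖pauliCoeff O a‖ ^ 2 = (hsInner O O).re := by
  rw [hsInner_self, Complex.ofReal_re]

theorem hsNorm_eq_one_iff (O : Op n d) : hsNorm O = 1 ↔ ∑ a, ‖pauliCoeff O a‖ ^ 2 = 1 := by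
  rw [hsNorm, Real.sqrt_eq_one, sum_norm_sq_pauliCoeff]

theorem trace_eq_zero_iff (O : Op n d) : O.trace = 0 ↔ pauliCoeff O 0 = 0 := by
  have hd : (d : ℂ) ^ n ≠ 0 := pow_ne_zero _ (Nat.cast_ne_zero.2 (NeZero.ne d))
  rw [pauliCoeff, hsInner, pauli_zero, Matrix.conjTranspose_one, one_mul, div_eq_zero_iff,
    or_iff_left hd]

theorem pauliCoeff_mul (A B : Op n d) (b : PauliLabel n d) :
    pauliCoeff (A * B) b =
      ∑ a, pauliCoeff A a * pauliCoeff B (b - a) * pauliPhase a (b - a) := by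
  conv_lhs => rw [← sum_pauliCoeff_smul_pauli A, ← sum_pauliCoeff_smul_pauli B,
    Finset.sum_mul_sum]
  rw [pauliCoeff_sum]
  refine Finset.sum_congr rfl fun a _ => ?_
  rw [pauliCoeff_sum, Finset.sum_eq_single (b - a)]
  · rw [smul_mul_smul_comm, pauli_mul, smul_smul, pauliCoeff_smul, pauliCoeff_pauli,
      add_sub_cancel, if_pos rfl, mul_one]
  · intro c _ hc
    rw [smul_mul_smul_comm, pauli_mul, smul_smul, pauliCoeff_smul, pauliCoeff_pauli,
      if_neg, mul_zero]
    rintro rfl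
    exact hc (by abel)
  · simp

theorem pauliCoeff_pauli_mul (e : PauliLabel n d) (O : Op n d) (a : PauliLabel n d) :
    pauliCoeff (pauli e * O) (a + e) = pauliPhase e a * pauliCoeff O a := by
  rw [pauliCoeff_mul, Finset.sum_eq_single e]
  · rw [pauliCoeff_pauli, if_pos rfl, add_sub_cancel_right]
    ring
  · intro b _ hb
    rw [pauliCoeff_pauli, if_neg hb, zero_mul, zero_mul]
  · simp

theorem pauliCoeff_mul_pauli (e : PauliLabel n d) (O : Op n d) (a : PauliLabel n d) :
    pauliCoeff (O * pauli e) (a + e) = pauliPhase a e * pauliCoeff O a := by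
  rw [pauliCoeff_mul, Finset.sum_eq_single a]
  · rw [add_sub_cancel_left, pauliCoeff_pauli, if_pos rfl]
    ring
  · intro b _ hb
    rw [pauliCoeff_pauli, if_neg, mul_zero, zero_mul]
    intro h
    exact hb (by rw [sub_eq_iff_eq_add, add_comm e b] at h; exact (add_right_cancel h).symm)
  · simp

/-- An operator commutes with everything on site `i` iff its Pauli expansion is trivial there. -/
theorem forall_commute_onSite_iff (i : Fin n) (O : Op n d) :
    (∀ M, Commute (onSite i M) O) ↔ ∀ a : PauliLabel n d, a i ≠ 0 → pauliCoeff O a = 0 := by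
  constructor
  · intro h a ha
    by_contra hc
    refine ha ?_
    -- Comparing coefficients at `a + Pi.single i p` in the commutation relation equates the two
    -- phases. The symplectic form is nondegenerate: testing on `Z` and `X` kills both components of
    -- `a i`.
    have key : ∀ p : ZMod d × ZMod d, p.2 * (a i).1 = (a i).2 * p.1 := by
      intro p
      have h1 := congrArg (fun A => pauliCoeff A (a + Pi.single i p)) (h (sitePauli p)).eq
      simp only [← pauli_single, pauliCoeff_pauli_mul, pauliCoeff_mul_pauli,
        pauliPhase_single_left, pauliPhase_single_right] at h1
      exact ZMod.injective_stdAddChar (mul_right_cancel₀ hc h1)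
    have h1 := key (0, 1)
    have h2 := key (1, 0)
    simp only [one_mul, mul_zero, mul_one, zero_mul] at h1 h2
    exact Prod.ext h1 h2.symm
  · intro h M
    rw [← sum_pauliCoeff_smul_pauli O]
    refine Commute.sum_right _ _ _ fun a _ => ?_
    by_cases ha : a i = 0
    · refine Commute.smul_right (onSite_commute_tensor i M _ ?_) _
      change Commute M (sitePauli (a i))
      rw [ha, sitePauli_zero]
      exact Commute.one_right M
    · rw [h a ha, zero_smul]
      exact Commute.zero_right _

end Basis

/-! ### Heisenberg evolution -/

section Evolve

variable {n d : ℕ} [NeZero d]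

/-- The Heisenberg evolution as a star algebra automorphism. -/
def evolveAut (U : Unitary n d) : Op n d ≃⋆ₐ[ℂ] Op n d :=
  _root_.Unitary.conjStarAlgAut ℂ (Op n d) (star U)

theorem evolveAut_apply (U : Unitary n d) (O : Op n d) : evolveAut U O = evolve U O :=
  _root_.Unitary.conjStarAlgAut_star_apply U O

theorem evolve_mul (U V : Unitary n d) (O : Op n d) :
    evolve (U * V) O = evolve V (evolve U O) := by
  simp only [evolve, Submonoid.coe_mul, Matrix.conjTranspose_mul, Matrix.mul_assoc]

theorem evolve_one (O : Op n d) : evolve (1 : Unitary n d) O = O := by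
  simp [evolve]

theorem evolve_inv_evolve (U : Unitary n d) (O : Op n d) : evolve U⁻¹ (evolve U O) = O := by
  rw [← evolve_mul, mul_inv_cancel, evolve_one]

theorem evolve_evolve_inv (U : Unitary n d) (O : Op n d) : evolve U (evolve U⁻¹ O) = O := by
  rw [← evolve_mul, inv_mul_cancel, evolve_one]

theorem evolve_commute (U : Unitary n d) {A B : Op n d} (h : Commute A B) :
    Commute (evolve U A) (evolve U B) := by
  simpa only [evolveAut_apply] using h.map (evolveAut U)

theorem trace_evolve (U : Unitary n d) (O : Op n d) : (evolve U O).trace = O.trace := by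
  have h : (U : Op n d) * (U : Op n d)ᴴ = 1 := Matrix.mem_unitaryGroup_iff.1 U.2
  rw [evolve, Matrix.trace_mul_comm, ← Matrix.mul_assoc, h, one_mul]

theorem hsInner_evolve (U : Unitary n d) (A B : Op n d) :
    hsInner (evolve U A) (evolve U B) = hsInner A B := by
  have h : (evolve U A)ᴴ * evolve U B = evolve U (Aᴴ * B) := by
    simp only [← evolveAut_apply, map_mul, ← Matrix.star_eq_conjTranspose, map_star]
  rw [hsInner, h, trace_evolve, hsInner]

theorem hsNorm_evolve (U : Unitary n d) (O : Op n d) : hsNorm (evolve U O) = hsNorm O := by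
  rw [hsNorm, hsInner_evolve, hsNorm]

theorem hsInner_evolve_left (U : Unitary n d) (A B : Op n d) :
    hsInner A (evolve U B) = hsInner (evolve U⁻¹ A) B := by
  rw [← hsInner_evolve U (evolve U⁻¹ A), evolve_evolve_inv]

end Evolve

/-! ### Weights of labels -/

section LabelWeight

variable {n d : ℕ}

theorem labelWeight_eq_zero_iff (a : PauliLabel n d) : labelWeight a = 0 ↔ a = 0 := by
  rw [labelWeight, Finset.card_eq_zero, Finset.filter_eq_empty_iff]
  simp only [Finset.mem_univ, true_imp_iff, not_not, funext_iff]
  rfl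

theorem labelWeight_eq_one_iff (a : PauliLabel n d) :
    labelWeight a = 1 ↔ ∃ i, ∃ p, p ≠ 0 ∧ a = Pi.single i p := by
  rw [labelWeight, Finset.card_eq_one]
  constructor
  · rintro ⟨i, hi⟩
    have hmem : ∀ j, a j ≠ 0 ↔ j = i := fun j => by
      have := Finset.ext_iff.1 hi j
      simpa only [Finset.mem_filter, Finset.mem_univ, true_and, Finset.mem_singleton,
        Prod.mk_zero_zero] using this
    refine ⟨i, a i, (hmem i).2 rfl, ?_⟩
    funext j
    by_cases h : j = i
    · subst h; simp
    · rw [Pi.single_eq_of_ne h]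
      by_contra hj
      exact h ((hmem j).1 hj)
  · rintro ⟨i, p, hp, rfl⟩
    refine ⟨i, ?_⟩
    ext j
    simp only [Finset.mem_filter, Finset.mem_univ, true_and, Finset.mem_singleton,
      Prod.mk_zero_zero]
    by_cases h : j = i
    · subst h; simpa using hp
    · simp [h]

theorem labelWeight_single (i : Fin n) {p : ZMod d × ZMod d} (hp : p ≠ 0) :
    labelWeight (Pi.single i p : PauliLabel n d) = 1 :=
  (labelWeight_eq_one_iff _).2 ⟨i, p, hp, rfl⟩

end LabelWeight

/-! ### The average weight as a sum over sites -/

section Weight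

variable {n d : ℕ} [NeZero d]

/-- The part of `O` whose Pauli expansion is trivial on site `i`. -/
def siteTrivialPart (i : Fin n) (O : Op n d) : Op n d :=
  ∑ a : PauliLabel n d, (if a i = 0 then pauliCoeff O a else 0) • pauli a

theorem pauliCoeff_siteTrivialPart (i : Fin n) (O : Op n d) (a : PauliLabel n d) :
    pauliCoeff (siteTrivialPart i O) a = if a i = 0 then pauliCoeff O a else 0 :=
  pauliCoeff_sum_smul_pauli (fun a => if a i = 0 then pauliCoeff O a else 0) a

/-- Since `|a|` counts sites, exchanging the sums makes each site contribute the squared mass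
nontrivial there. -/
theorem avgWeight_eq_sum_sites (O : Op n d) :
    avgWeight O =
      ∑ i, ((hsInner O O).re - (hsInner (siteTrivialPart i O) (siteTrivialPart i O)).re) := by
  simp only [← sum_norm_sq_pauliCoeff, ← Finset.sum_sub_distrib, pauliCoeff_siteTrivialPart]
  rw [avgWeight, Finset.sum_comm]
  refine Finset.sum_congr rfl fun a _ => ?_
  rw [labelWeight, Finset.card_eq_sum_ones, Finset.sum_filter, Nat.cast_sum, Finset.sum_mul]
  refine Finset.sum_congr rfl fun i _ => ?_
  rw [Prod.mk_zero_zero]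
  by_cases h : a i = 0 <;> simp [h]

/-- Evolution under a unitary that permutes the single-site algebras permutes the
site-trivial parts. -/
theorem evolve_siteTrivialPart {U : Unitary n d} {i j : Fin n}
    (h₁ : ∀ M, ∃ M', evolve U (onSite i M) = onSite j M')
    (h₂ : ∀ M, ∃ M', evolve U (onSite i M') = onSite j M) (O : Op n d) :
    evolve U (siteTrivialPart i O) = siteTrivialPart j (evolve U O) := by
  refine ext_pauliCoeff fun a => ?_
  rw [pauliCoeff_siteTrivialPart]
  split_ifs with ha
  -- Pulled back by `U`, a Pauli trivial on `j` is trivial on `i`, so its inner product with `O`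
  -- does not see the truncation.
  · have hcomm : ∀ M, Commute (onSite i M) (evolve U⁻¹ (pauli a)) := by
      intro M
      obtain ⟨M', hM'⟩ := h₁ M
      have hc : Commute (onSite j M') (pauli a) :=
        (forall_commute_onSite_iff j (pauli a)).2 (fun b hb => by
          rw [pauliCoeff_pauli, if_neg]; rintro rfl; exact hb ha) M'
      have := evolve_commute U⁻¹ hc
      rwa [← hM', evolve_inv_evolve] at this
    rw [forall_commute_onSite_iff] at hcomm
    rw [pauliCoeff, pauliCoeff, hsInner_evolve_left, hsInner_evolve_left, hsInner_eq_sum,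
      hsInner_eq_sum]
    refine Finset.sum_congr rfl fun b _ => ?_
    rw [pauliCoeff_siteTrivialPart]
    split_ifs with hb
    · rfl
    · rw [hcomm b hb, star_zero, zero_mul, zero_mul]
  -- By `h₂` every operator on `j` comes from site `i`, hence commutes with the evolved trivial
  -- part.
  · refine (forall_commute_onSite_iff j _).1 (fun M => ?_) a ha
    obtain ⟨M', hM'⟩ := h₂ M
    rw [← hM']
    refine evolve_commute U ((forall_commute_onSite_iff i _).2 (fun b hb => ?_) M')
    rw [pauliCoeff_siteTrivialPart, if_neg hb]

theorem avgWeight_evolve_of_perm {U : Unitary n d} (σ : Equiv.Perm (Fin n))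
    (h₁ : ∀ i M, ∃ M', evolve U (onSite i M) = onSite (σ i) M')
    (h₂ : ∀ i M, ∃ M', evolve U (onSite i M') = onSite (σ i) M) (O : Op n d) :
    avgWeight (evolve U O) = avgWeight O := by
  rw [avgWeight_eq_sum_sites, avgWeight_eq_sum_sites, ← Equiv.sum_comp σ]
  refine Finset.sum_congr rfl fun i _ => ?_
  rw [← evolve_siteTrivialPart (h₁ i) (h₂ i), hsInner_evolve, hsInner_evolve]

theorem avgWeight_pauli (a : PauliLabel n d) : avgWeight (pauli a) = labelWeight a := by
  rw [avgWeight, Finset.sum_eq_single a]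
  · simp [pauliCoeff_pauli]
  · intro b _ hb
    simp [pauliCoeff_pauli, hb]
  · simp

theorem hsNorm_pauli (a : PauliLabel n d) : hsNorm (pauli a) = 1 := by
  simp [hsNorm, hsInner_pauli]

theorem trace_pauli {a : PauliLabel n d} (ha : a ≠ 0) : (pauli a).trace = 0 := by
  rw [trace_eq_zero_iff, pauliCoeff_pauli, if_neg ha.symm]

/-- The Pauli expansion of `O` involves only Pauli operators of weight one. -/
def IsWeightOne (O : Op n d) : Prop :=
  ∀ a, labelWeight a ≠ 1 → pauliCoeff O a = 0

/-- The factor is negative only at `a = 0`, where tracelessness kills the coefficient. -/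
theorem weight_sub_one_mul_nonneg {O : Op n d} (htr : O.trace = 0) (a : PauliLabel n d) :
    0 ≤ ((labelWeight a : ℝ) - 1) * ‖pauliCoeff O a‖ ^ 2 := by
  by_cases ha : a = 0
  · rw [ha, (trace_eq_zero_iff O).1 htr]
    simp
  · have h : 1 ≤ labelWeight a :=
      Nat.one_le_iff_ne_zero.2 fun h => ha ((labelWeight_eq_zero_iff a).1 h)
    have h' : (1 : ℝ) ≤ labelWeight a := by exact_mod_cast h
    exact mul_nonneg (sub_nonneg.2 h') (sq_nonneg _)

theorem avgWeight_sub_one {O : Op n d} (hO : hsNorm O = 1) :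
    avgWeight O - 1 = ∑ a, ((labelWeight a : ℝ) - 1) * ‖pauliCoeff O a‖ ^ 2 := by
  rw [hsNorm_eq_one_iff] at hO
  simp only [sub_mul, one_mul, Finset.sum_sub_distrib, hO, avgWeight]

theorem one_le_avgWeight {O : Op n d} (hO : hsNorm O = 1) (htr : O.trace = 0) :
    1 ≤ avgWeight O := by
  rw [← sub_nonneg, avgWeight_sub_one hO]
  exact Finset.sum_nonneg fun a _ => weight_sub_one_mul_nonneg htr a

theorem avgWeight_eq_one_iff {O : Op n d} (hO : hsNorm O = 1) (htr : O.trace = 0) :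
    avgWeight O = 1 ↔ IsWeightOne O := by
  rw [← sub_eq_zero, avgWeight_sub_one hO,
    Finset.sum_eq_zero_iff_of_nonneg fun a _ => weight_sub_one_mul_nonneg htr a]
  refine forall_congr' fun a => ?_
  simp only [Finset.mem_univ, true_imp_iff, mul_eq_zero, sub_eq_zero, Nat.cast_eq_one, ne_eq,
    OfNat.ofNat_ne_zero, not_false_eq_true, pow_eq_zero_iff, norm_eq_zero]
  tauto

/-- `IsWeightOne` is linear, whereas `avgWeight` is quadratic; this carries the condition from
Paulis to their span. -/
theorem IsNonEntangling.isWeightOne_evolve {U : Unitary n d} (hU : IsNonEntangling U)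
    {O : Op n d} (hO : IsWeightOne O) : IsWeightOne (evolve U O) := by
  intro b hb
  rw [← sum_pauliCoeff_smul_pauli O, ← evolveAut_apply, map_sum, pauliCoeff_sum]
  refine Finset.sum_eq_zero fun a _ => ?_
  rw [map_smul, pauliCoeff_smul, evolveAut_apply]
  by_cases ha : labelWeight a = 1
  · have ha0 : a ≠ 0 := fun h => by
      rw [(labelWeight_eq_zero_iff a).2 h] at ha
      exact zero_ne_one ha
    have := (avgWeight_eq_one_iff (by rw [hsNorm_evolve, hsNorm_pauli])
      (by rw [trace_evolve, trace_pauli ha0])).1 (hU a ha) b hb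
    rw [this, mul_zero]
  · rw [hO a ha, zero_mul]

end Weight

/-! ### Permutations of the sites -/

section Perm

variable {n d : ℕ}

/-- The operator `|y⟩ ↦ |y ∘ σ⟩` that permutes the sites. -/
def permOp (σ : Equiv.Perm (Fin n)) : Op n d :=
  Matrix.of fun x y => if x = y ∘ σ then 1 else 0

theorem permOp_apply (σ : Equiv.Perm (Fin n)) (x y : Config n d) :
    permOp σ x y = if x = y ∘ σ then 1 else 0 := rfl

/-- Precomposition is a right action, hence the reversed order. -/
theorem permOp_mul [NeZero d] (σ τ : Equiv.Perm (Fin n)) :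
    (permOp σ * permOp τ : Op n d) = permOp (τ * σ) := by
  ext x y
  simp [Matrix.mul_apply, permOp_apply, Function.comp_assoc]
  congr

theorem permOp_one : (permOp 1 : Op n d) = 1 := by
  ext x y
  simp [permOp_apply, Matrix.one_apply]

theorem comp_perm_eq_iff (σ : Equiv.Perm (Fin n)) (x y : Config n d) :
    x = y ∘ σ ↔ y = x ∘ σ.symm := by
  constructor
  · rintro rfl
    funext i
    simp
  · rintro rfl
    funext i
    simp

theorem conjTranspose_permOp (σ : Equiv.Perm (Fin n)) :
    (permOp σ : Op n d)ᴴ = permOp σ.symm := by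
  ext x y
  simp only [Matrix.conjTranspose_apply, permOp_apply, comp_perm_eq_iff σ y x]
  split_ifs <;> simp

/-- The operator `permOp σ` as a unitary. -/
def permUnitary [NeZero d] (σ : Equiv.Perm (Fin n)) : Unitary n d :=
  ⟨permOp σ, by
    rw [Matrix.mem_unitaryGroup_iff, Matrix.star_eq_conjTranspose, conjTranspose_permOp,
      permOp_mul, show σ.symm * σ = 1 from inv_mul_cancel σ, permOp_one]⟩

theorem coe_permUnitary [NeZero d] (σ : Equiv.Perm (Fin n)) :
    ((permUnitary σ : Unitary n d) : Op n d) = permOp σ := rfl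

theorem permUnitary_mul [NeZero d] (σ τ : Equiv.Perm (Fin n)) :
    (permUnitary σ * permUnitary τ : Unitary n d) = permUnitary (τ * σ) :=
  Subtype.ext (permOp_mul σ τ)

theorem tensor_mul_permOp [NeZero d] (σ : Equiv.Perm (Fin n)) (A : Fin n → Matrix (ZMod d) (ZMod d) ℂ) :
    tensor A * permOp σ = permOp σ * tensor (A ∘ σ.symm) := by
  ext x y
  have h1 : (tensor A * permOp σ : Op n d) x y = tensor A x (y ∘ σ) := by
    simp [Matrix.mul_apply, permOp_apply]
  have h2 : (permOp σ * tensor (A ∘ σ.symm) : Op n d) x y = tensor (A ∘ σ.symm) (x ∘ σ.symm) y := by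
    simp [Matrix.mul_apply, permOp_apply, comp_perm_eq_iff σ x]
  rw [h1, h2, tensor_apply, tensor_apply]
  exact Fintype.prod_equiv σ _ _ fun i => by simp

theorem evolve_permUnitary_tensor [NeZero d] (σ : Equiv.Perm (Fin n))
    (A : Fin n → Matrix (ZMod d) (ZMod d) ℂ) :
    evolve (permUnitary σ) (tensor A) = tensor (A ∘ σ.symm) := by
  rw [evolve, coe_permUnitary, Matrix.mul_assoc, tensor_mul_permOp, ← Matrix.mul_assoc,
    conjTranspose_permOp, permOp_mul, show σ * σ.symm = 1 from mul_inv_cancel σ, permOp_one, one_mul]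

theorem evolve_permUnitary_onSite [NeZero d] (σ : Equiv.Perm (Fin n)) (i : Fin n)
    (M : Matrix (ZMod d) (ZMod d) ℂ) :
    evolve (permUnitary σ) (onSite i M) = onSite (σ i) M := by
  rw [onSite, evolve_permUnitary_tensor, onSite]
  congr 1
  funext j
  simp only [Function.comp_apply, Function.update_apply, Equiv.symm_apply_eq]

theorem permUnitary_mem_localSwapGroup [NeZero d] (σ : Equiv.Perm (Fin n)) :
    permUnitary σ ∈ localSwapGroup n d := by
  induction σ using Equiv.Perm.swap_induction_on with
  | one =>
    have : (permUnitary 1 : Unitary n d) = 1 := Subtype.ext permOp_one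
    rw [this]
    exact one_mem _
  | swap_mul f x y _ ih =>
    rw [← permUnitary_mul]
    exact mul_mem ih (Subgroup.subset_closure (Or.inl ⟨x, y, rfl⟩))

end Perm

/-! ### The group generated by swaps and single-site unitaries -/

section LocalSwap

variable {n d : ℕ} [NeZero d]

theorem avgWeight_evolve_of_mem_localSwapGroup {U : Unitary n d} (hU : U ∈ localSwapGroup n d)
    (O : Op n d) : avgWeight (evolve U O) = avgWeight O := by
  induction hU using Subgroup.closure_induction generalizing O with
  | mem U hU =>
    rcases hU with ⟨i, j, h⟩ | ⟨i, u, hu, h⟩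
    · obtain rfl : U = permUnitary (Equiv.swap i j) := Subtype.ext h
      refine avgWeight_evolve_of_perm (Equiv.swap i j)
        (fun k M => ⟨M, evolve_permUnitary_onSite _ k M⟩)
        (fun k M => ⟨M, evolve_permUnitary_onSite _ k M⟩) O
    · have huu : uᴴ * u = 1 := Matrix.mem_unitaryGroup_iff'.1 hu
      have hev : ∀ M, evolve U (onSite i M) = onSite i (uᴴ * M * u) := fun M => by
        rw [evolve, h, conjTranspose_onSite, ← onSite_mul, ← onSite_mul]
      have hev' : ∀ k, k ≠ i → ∀ M, evolve U (onSite k M) = onSite k M := fun k hk M => by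
        rw [evolve, h, Matrix.mul_assoc, (onSite_commute hk M u).eq, ← Matrix.mul_assoc,
          conjTranspose_onSite, ← onSite_mul, huu, onSite_one, one_mul]
      refine avgWeight_evolve_of_perm 1 (fun k M => ?_) (fun k M => ?_) O
      · by_cases hk : k = i
        · subst hk; exact ⟨_, hev M⟩
        · exact ⟨_, hev' k hk M⟩
      · by_cases hk : k = i
        · subst hk
          refine ⟨u * M * uᴴ, ?_⟩
          rw [hev, Matrix.mul_assoc u, ← Matrix.mul_assoc, huu, one_mul, Matrix.mul_assoc, huu,
            mul_one]
          rfl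
        · exact ⟨_, hev' k hk M⟩
  | one => rw [evolve_one]
  | mul U V _ _ hU hV => rw [evolve_mul, hV, hU]
  | inv U _ hU => rw [← hU, evolve_evolve_inv]

theorem isNonEntangling_of_mem_localSwapGroup {U : Unitary n d} (hU : U ∈ localSwapGroup n d) :
    IsNonEntangling U := by
  intro a ha
  rw [avgWeight_evolve_of_mem_localSwapGroup hU, avgWeight_pauli, ha, Nat.cast_one]

theorem tensor_mem_localSwapGroup {u : Fin n → Matrix (ZMod d) (ZMod d) ℂ}
    (hu : ∀ i, u i ∈ Matrix.unitaryGroup (ZMod d) ℂ) :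
    ∃ T ∈ localSwapGroup n d, (T : Op n d) = tensor u := by
  have key : ∀ s : Finset (Fin n), ∃ T ∈ localSwapGroup n d,
      (T : Op n d) = tensor fun i => if i ∈ s then u i else 1 := by
    intro s
    induction s using Finset.induction_on with
    | empty => exact ⟨1, one_mem _, by simp [tensor_one]⟩
    | insert i s hi ih =>
      obtain ⟨T, hT, hTu⟩ := ih
      have hmem : onSite i (u i) ∈ Matrix.unitaryGroup (Config n d) ℂ := by
        rw [Matrix.mem_unitaryGroup_iff, Matrix.star_eq_conjTranspose, conjTranspose_onSite,
          ← onSite_mul, ← Matrix.star_eq_conjTranspose, Matrix.mem_unitaryGroup_iff.1 (hu i),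
          onSite_one]
      refine ⟨⟨onSite i (u i), hmem⟩ * T,
        mul_mem (Subgroup.subset_closure (Or.inr ⟨i, u i, hu i, rfl⟩)) hT, ?_⟩
      rw [Submonoid.coe_mul, hTu]
      change onSite i (u i) * _ = _
      rw [onSite, tensor_mul]
      congr 1
      funext j
      by_cases hj : j = i
      · subst hj; simp [hi]
      · simp [hj]
  simpa using key Finset.univ

end LocalSwap

/-- An injective star endomorphism of a matrix algebra is conjugation by a unitary. -/
theorem exists_unitary_mul_eq {m : Type*} [Fintype m] [DecidableEq m] [Nonempty m]
    (f : Matrix m m ℂ →⋆ₐ[ℂ] Matrix m m ℂ) (hf : Function.Injective f) :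
    ∃ u ∈ Matrix.unitaryGroup m ℂ, ∀ M, f M * u = u * M := by
  obtain ⟨k₀⟩ := ‹Nonempty m›
  let E : m → m → Matrix m m ℂ := fun i j => Matrix.single i j 1
  have hEE : ∀ i j k, E i j * E j k = E i k := fun i j k => by
    simp [E]
  have hE0 : ∀ i j k l, j ≠ k → E i j * E k l = 0 := fun i j k l h => by
    simp [E, h]
  have hstar : ∀ i j, (f (E i j))ᴴ = f (E j i) := fun i j => by
    rw [← Matrix.star_eq_conjTranspose, ← map_star, Matrix.star_eq_conjTranspose]
    simp [E, Matrix.conjTranspose_single]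
  have hP : f (E k₀ k₀) ≠ 0 := by
    rw [← map_zero f]
    refine hf.ne fun h => ?_
    have := congrFun (congrFun h k₀) k₀
    simp [E] at this
  obtain ⟨a₀, b, hab⟩ : ∃ a b, f (E k₀ k₀) a b ≠ 0 := by
    by_contra! h
    exact hP (Matrix.ext h)
  set r : ℝ := ∑ a, ‖f (E k₀ k₀) a b‖ ^ 2 with hr
  have hr0 : 0 < r :=
    Finset.sum_pos' (fun a _ => sq_nonneg _) ⟨a₀, Finset.mem_univ _, by positivity⟩
  have hPr : f (E k₀ k₀) b b = r := by
    -- The image of `E k₀ k₀` is a projection, so its diagonal entry at `b` is the squared norm of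
    -- column `b`.
    have h : f (E k₀ k₀) = (f (E k₀ k₀))ᴴ * f (E k₀ k₀) := by
      rw [hstar, ← map_mul, hEE]
    rw [h, Matrix.mul_apply, hr]
    push_cast
    exact Finset.sum_congr rfl fun a _ => Complex.conj_mul' _
  set s : ℂ := Complex.ofReal (Real.sqrt r)⁻¹ with hs
  have hss : star s * s * r = 1 := by
    have h1 : star s = s := Complex.conj_ofReal _
    rw [h1, hs]
    norm_cast
    rw [← mul_inv, Real.mul_self_sqrt hr0.le, inv_mul_cancel₀ hr0.ne']
  -- Column `j` of the unitary is `f (E j k₀)` applied to the basis vector `b`, normalised by `s`.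
  -- The matrix unit relations give orthonormality and the intertwining property.
  refine ⟨Matrix.of fun a j => f (E j k₀) a b * s, ?_, fun M => ?_⟩
  · rw [Matrix.mem_unitaryGroup_iff']
    ext j k
    have h1 : (star (Matrix.of fun a j => f (E j k₀) a b * s) *
        (Matrix.of fun a j => f (E j k₀) a b * s)) j k =
        star s * s * ((f (E j k₀))ᴴ * f (E k k₀)) b b := by
      rw [Matrix.mul_apply, Matrix.mul_apply, Finset.mul_sum]
      refine Finset.sum_congr rfl fun a _ => ?_
      simp only [Matrix.star_apply, Matrix.of_apply, Matrix.conjTranspose_apply, star_mul']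
      ring
    rw [h1, hstar, ← map_mul, Matrix.one_apply]
    split_ifs with hjk
    · rw [hjk, hEE, hPr, hss]
    · rw [hE0 _ _ _ _ hjk, map_zero, Matrix.zero_apply, mul_zero]
  · ext a k
    have h1 : (f M * Matrix.of fun a j => f (E j k₀) a b * s) a k = f (M * E k k₀) a b * s := by
      rw [map_mul, Matrix.mul_apply, Matrix.mul_apply, Finset.sum_mul]
      exact Finset.sum_congr rfl fun c _ => by rw [Matrix.of_apply, mul_assoc]
    have h2 : M * E k k₀ = ∑ j, M j k • E j k₀ := by
      ext x y
      rw [Matrix.sum_apply, Matrix.mul_apply]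
      simp [E, Matrix.single_apply, ite_and]
    rw [h1, h2, map_sum, Matrix.sum_apply, Matrix.mul_apply, Finset.sum_mul]
    refine Finset.sum_congr rfl fun j _ => ?_
    rw [map_smul, Matrix.smul_apply, Matrix.of_apply, smul_eq_mul]
    ring

/-! ### Non-entangling unitaries permute the single-site algebras -/

section Structure

variable {n d : ℕ}

theorem labelWeight_ne_one {a : PauliLabel n d} {j k : Fin n} (hjk : j ≠ k) (hj : a j ≠ 0)
    (hk : a k ≠ 0) : labelWeight a ≠ 1 := by
  intro h
  obtain ⟨l, p, -, rfl⟩ := (labelWeight_eq_one_iff a).1 h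
  have h1 : j = l := by
    by_contra h; exact hj (by rw [Pi.single_eq_of_ne h])
  have h2 : k = l := by
    by_contra h; exact hk (by rw [Pi.single_eq_of_ne h])
  exact hjk (h1.trans h2.symm)

variable [NeZero d]

theorem pauliCoeff_onSite {i j : Fin n} (hij : j ≠ i) (M : Matrix (ZMod d) (ZMod d) ℂ)
    {a : PauliLabel n d} (ha : a j ≠ 0) : pauliCoeff (onSite i M) a = 0 :=
  (forall_commute_onSite_iff j _).1 (fun N => onSite_commute hij N M) a ha

theorem isWeightOne_onSite (i : Fin n) {M : Matrix (ZMod d) (ZMod d) ℂ} (hM : M.trace = 0) :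
    IsWeightOne (onSite i M) := by
  intro a ha
  by_cases h : ∃ j, j ≠ i ∧ a j ≠ 0
  · obtain ⟨j, hj, haj⟩ := h
    exact pauliCoeff_onSite hj M haj
  · push Not at h
    have hai : a = Pi.single i (a i) := by
      funext j
      by_cases hj : j = i
      · subst hj; simp
      · rw [Pi.single_eq_of_ne hj, h j hj]
    have hai0 : a i = 0 := by
      by_contra h0
      rw [hai] at ha
      exact ha (labelWeight_single i h0)
    rw [hai, hai0, Pi.single_zero, ← trace_eq_zero_iff, onSite, trace_tensor]
    exact Finset.prod_eq_zero (Finset.mem_univ i) (by simpa using hM)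

theorem exists_trace_eq_zero_add_smul_one (M : Matrix (ZMod d) (ZMod d) ℂ) :
    ∃ N : Matrix (ZMod d) (ZMod d) ℂ, ∃ t : ℂ, N.trace = 0 ∧ M = N + t • 1 := by
  refine ⟨M - (M.trace / d) • 1, M.trace / d, ?_, (sub_add_cancel _ _).symm⟩
  have hd : (d : ℂ) ≠ 0 := Nat.cast_ne_zero.2 (NeZero.ne d)
  simp [Matrix.trace_sub, Matrix.trace_smul, ZMod.card, hd]

theorem exists_eq_onSite {j : Fin n} {O : Op n d}
    (h : ∀ a, ∀ k, k ≠ j → a k ≠ 0 → pauliCoeff O a = 0) : ∃ M, O = onSite j M := by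
  refine ⟨∑ a : PauliLabel n d, pauliCoeff O a • sitePauli (a j), ?_⟩
  conv_lhs => rw [← sum_pauliCoeff_smul_pauli O]
  rw [← onSiteHom_apply, map_sum]
  refine Finset.sum_congr rfl fun a _ => ?_
  rw [map_smul, onSiteHom_apply, ← pauli_single]
  by_cases ha : ∃ k, k ≠ j ∧ a k ≠ 0
  · obtain ⟨k, hk, hak⟩ := ha
    rw [h a k hk hak, zero_smul, zero_smul]
  · push Not at ha
    congr 2
    funext k
    by_cases hk : k = j
    · subst hk; simp
    · rw [Pi.single_eq_of_ne hk, ha k hk]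

/-- A label supported on two sites is a sum of two weight-one labels in just two ways, one per
order, and disjoint supports give phase 1. -/
theorem IsWeightOne.pauliCoeff_mul_self {O : Op n d} (hO : IsWeightOne O) {j k : Fin n}
    (hjk : j ≠ k) {p q : ZMod d × ZMod d} (hp : p ≠ 0) (hq : q ≠ 0) :
    pauliCoeff (O * O) (Pi.single j p + Pi.single k q) =
      2 * (pauliCoeff O (Pi.single j p) * pauliCoeff O (Pi.single k q)) := by
  have hdisj : ∀ l, (Pi.single j p : PauliLabel n d) l = 0 ∨
      (Pi.single k q : PauliLabel n d) l = 0 := fun l => by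
    by_cases hl : l = j
    · right
      rw [hl, Pi.single_eq_of_ne hjk]
    · left
      rw [Pi.single_eq_of_ne hl]
  have hne : (Pi.single j p : PauliLabel n d) ≠ Pi.single k q := fun h => by
    have := congrFun h j
    rw [Pi.single_eq_same, Pi.single_eq_of_ne hjk] at this
    exact hp this
  rw [pauliCoeff_mul, Fintype.sum_eq_add _ _ hne]
  · rw [add_sub_cancel_left, add_sub_cancel_right, pauliPhase_of_disjoint hdisj,
      pauliPhase_of_disjoint fun l => (hdisj l).symm]
    ring
  · rintro a ⟨haj, hak⟩
    by_cases ha : labelWeight a = 1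
    · obtain ⟨l, r, hr, rfl⟩ := (labelWeight_eq_one_iff a).1 ha
      have hw : labelWeight (Pi.single j p + Pi.single k q - Pi.single l r :
          PauliLabel n d) ≠ 1 := by
        refine labelWeight_ne_one hjk ?_ ?_
        · by_cases hl : j = l
          · subst hl
            rw [Pi.sub_apply, Pi.add_apply, Pi.single_eq_same, Pi.single_eq_same,
              Pi.single_eq_of_ne hjk, add_zero, sub_ne_zero]
            rintro rfl
            exact haj rfl
          · simpa [hl, hjk] using hp
        · by_cases hl : k = l
          · subst hl
            rw [Pi.sub_apply, Pi.add_apply, Pi.single_eq_same, Pi.single_eq_same,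
              Pi.single_eq_of_ne hjk.symm, zero_add, sub_ne_zero]
            rintro rfl
            exact hak rfl
          · simpa [hl, hjk.symm] using hq
      rw [hO _ hw, mul_zero, zero_mul]
    · rw [hO a ha, zero_mul, zero_mul]

theorem evolve_add (U : Unitary n d) (A B : Op n d) :
    evolve U (A + B) = evolve U A + evolve U B := by
  simp only [← evolveAut_apply, map_add]

theorem IsNonEntangling.pauliCoeff_evolve_mul_eq_zero {U : Unitary n d} (hU : IsNonEntangling U)
    (i : Fin n) {M : Matrix (ZMod d) (ZMod d) ℂ} (hM : M.trace = 0) {j k : Fin n} (hjk : j ≠ k)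
    {p q : ZMod d × ZMod d} (hp : p ≠ 0) (hq : q ≠ 0) :
    pauliCoeff (evolve U (onSite i M)) (Pi.single j p) *
      pauliCoeff (evolve U (onSite i M)) (Pi.single k q) = 0 := by
  have h2 := (hU.isWeightOne_evolve (isWeightOne_onSite i hM)).pauliCoeff_mul_self hjk hp hq
  have hbj : (Pi.single j p + Pi.single k q : PauliLabel n d) j ≠ 0 := by
    simpa [hjk] using hp
  have hbk : (Pi.single j p + Pi.single k q : PauliLabel n d) k ≠ 0 := by
    simpa [hjk.symm] using hq
  -- The square evolves to a weight-one operator plus a scalar, so it has no coefficient on two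
  -- sites.
  obtain ⟨N, t, hN, hMN⟩ := exists_trace_eq_zero_add_smul_one (M * M)
  have h3 : evolve U (onSite i M) * evolve U (onSite i M) =
      evolve U (onSite i N) + t • pauli 0 := by
    rw [pauli_zero, ← evolveAut_apply, ← map_mul, ← onSite_mul, hMN, onSite_add, onSite_smul,
      onSite_one, map_add, map_smul, map_one, evolveAut_apply]
  rw [h3, pauliCoeff_add, pauliCoeff_smul, pauliCoeff_pauli, if_neg, mul_zero,
    hU.isWeightOne_evolve (isWeightOne_onSite i hN) _ (labelWeight_ne_one hjk hbj hbk),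
    add_zero] at h2
  · exact (mul_eq_zero.1 h2.symm).resolve_left two_ne_zero
  · intro h
    rw [h] at hbj
    exact hbj rfl

theorem IsNonEntangling.exists_site (hd : 2 ≤ d) {U : Unitary n d} (hU : IsNonEntangling U)
    (i : Fin n) : ∃ j, ∀ M, ∃ M', evolve U (onSite i M) = onSite j M' := by
  have : Fact (1 < d) := ⟨hd⟩
  have hp₀ : ((1, 0) : ZMod d × ZMod d) ≠ 0 := fun h => one_ne_zero (congrArg Prod.fst h)
  set M₀ : Matrix (ZMod d) (ZMod d) ℂ := sitePauli (1, 0) with hM₀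
  have htr₀ : M₀.trace = 0 := by
    have := trace_sitePauli_conjTranspose_mul (0 : ZMod d × ZMod d) (1, 0)
    rwa [sitePauli_zero, Matrix.conjTranspose_one, one_mul, if_neg hp₀.symm] at this
  have hw₀ : IsWeightOne (evolve U (onSite i M₀)) :=
    hU.isWeightOne_evolve (isWeightOne_onSite i htr₀)
  obtain ⟨j, p, hp, hjp⟩ : ∃ j, ∃ p, p ≠ 0 ∧
      pauliCoeff (evolve U (onSite i M₀)) (Pi.single j p) ≠ 0 := by
    by_contra! h
    have hnorm : hsNorm (evolve U (onSite i M₀)) = 1 := by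
      rw [hsNorm_evolve, hM₀, ← pauli_single, hsNorm_pauli]
    rw [hsNorm_eq_one_iff, Finset.sum_eq_zero] at hnorm
    · exact zero_ne_one hnorm
    · intro a _
      by_cases ha : labelWeight a = 1
      · obtain ⟨j, p, hp, rfl⟩ := (labelWeight_eq_one_iff a).1 ha
        simp [h j p hp]
      · simp [hw₀ a ha]
  have hoff : ∀ M : Matrix (ZMod d) (ZMod d) ℂ, M.trace = 0 → ∀ k, k ≠ j → ∀ q, q ≠ 0 →
      pauliCoeff (evolve U (onSite i M)) (Pi.single k q) = 0 := by
    intro M hM k hk q hq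
    by_contra hc
    have h0 := (mul_eq_zero.1
      (hU.pauliCoeff_evolve_mul_eq_zero i htr₀ hk.symm hp hq)).resolve_left hjp
    have h1 := (mul_eq_zero.1
      (hU.pauliCoeff_evolve_mul_eq_zero i hM hk.symm hp hq)).resolve_right hc
    -- If the image of `M` reached another site `k`, that of `M₀ + M` would occupy both `j` and `k`.
    have hsum := hU.pauliCoeff_evolve_mul_eq_zero i (M := M₀ + M)
      (by rw [Matrix.trace_add, htr₀, hM, add_zero]) hk.symm hp hq
    rw [onSite_add, evolve_add, pauliCoeff_add, pauliCoeff_add, h0, h1, add_zero, zero_add] at hsum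
    exact mul_ne_zero hjp hc hsum
  refine ⟨j, fun M => exists_eq_onSite fun a k hk hak => ?_⟩
  obtain ⟨N, t, hN, rfl⟩ := exists_trace_eq_zero_add_smul_one M
  have h1 : evolve U (onSite i (N + t • 1)) = evolve U (onSite i N) + t • pauli 0 := by
    rw [pauli_zero, onSite_add, onSite_smul, onSite_one, ← evolveAut_apply, map_add, map_smul,
      map_one, evolveAut_apply]
  have ha0 : a ≠ 0 := fun h => hak (by rw [h]; rfl)
  rw [h1, pauliCoeff_add, pauliCoeff_smul, pauliCoeff_pauli, if_neg ha0, mul_zero, add_zero]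
  by_cases ha : labelWeight a = 1
  · obtain ⟨l, q, hq, rfl⟩ := (labelWeight_eq_one_iff a).1 ha
    have hl : k = l := by
      by_contra h
      exact hak (by rw [Pi.single_eq_of_ne h])
    subst hl
    exact hoff N hN k hk q hq
  · exact hU.isWeightOne_evolve (isWeightOne_onSite i hN) a ha

/-- A homomorphism of single-site algebras induced by an evolution. -/
theorem exists_starAlgHom {U : Unitary n d} {i j : Fin n}
    (h : ∀ M, ∃ M', evolve U (onSite i M) = onSite j M') :
    ∃ f : Matrix (ZMod d) (ZMod d) ℂ →⋆ₐ[ℂ] Matrix (ZMod d) (ZMod d) ℂ,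
      Function.Injective f ∧ ∀ M, evolve U (onSite i M) = onSite j (f M) := by
  choose f hf using h
  have hf' : ∀ M, onSiteHom j (f M) = evolveAut U (onSiteHom i M) := fun M => by
    rw [onSiteHom_apply, onSiteHom_apply, evolveAut_apply, hf]
  have hinj : Function.Injective
      (onSiteHom j : Matrix (ZMod d) (ZMod d) ℂ →⋆ₐ[ℂ] Op n d) := onSite_injective j
  refine ⟨{ toFun := f
            map_one' := hinj (by rw [hf', map_one, map_one, map_one])
            map_mul' := fun A B => hinj (by simp only [hf', map_mul])
            map_zero' := hinj (by rw [hf', map_zero, map_zero, map_zero])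
            map_add' := fun A B => hinj (by simp only [hf', map_add])
            commutes' := fun c => hinj (by simp only [hf', AlgHomClass.commutes])
            map_star' := fun A => hinj (by simp only [hf', map_star]) }, ?_, hf⟩
  intro A B hAB
  have h1 : f A = f B := hAB
  have h2 : evolveAut U (onSite i A) = evolveAut U (onSite i B) := by
    rw [evolveAut_apply, evolveAut_apply, hf, hf, h1]
  exact onSite_injective i ((evolveAut U).injective h2)

/-- A non-entangling unitary permutes the sites and acts on each by a star homomorphism. -/
theorem IsNonEntangling.exists_perm (hd : 2 ≤ d) {U : Unitary n d} (hU : IsNonEntangling U) :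
    ∃ (σ : Equiv.Perm (Fin n))
      (f : Fin n → Matrix (ZMod d) (ZMod d) ℂ →⋆ₐ[ℂ] Matrix (ZMod d) (ZMod d) ℂ),
      (∀ i, Function.Injective (f i)) ∧ ∀ i M, evolve U (onSite i M) = onSite (σ i) (f i M) := by
  have : Fact (1 < d) := ⟨hd⟩
  have hp₀ : ((1, 0) : ZMod d × ZMod d) ≠ 0 := fun h => one_ne_zero (congrArg Prod.fst h)
  choose σ hσ using hU.exists_site hd
  choose f hfinj hf using fun i => exists_starAlgHom (hσ i)
  have hσinj : Function.Injective σ := by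
    intro i k hik
    by_contra hne
    -- If sites `i` and `k` had the same image, surjectivity (from finite dimension) would make `X`
    -- on site `k` equal to an operator on site `i`.
    have hsurj : Function.Surjective (f i) :=
      (LinearMap.injective_iff_surjective (f := (f i).toAlgHom.toLinearMap)).1 (hfinj i)
    obtain ⟨M, hM⟩ := hsurj (f k (sitePauli (1, 0)))
    have h1 : evolveAut U (onSite i M) = evolveAut U (onSite k (sitePauli (1, 0))) := by
      rw [evolveAut_apply, evolveAut_apply, hf, hf, hM, hik]
    have h2 := (evolveAut U).injective h1
    have h3 := pauliCoeff_onSite (i := i) (j := k) (Ne.symm hne) M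
      (a := Pi.single k (1, 0)) (by rw [Pi.single_eq_same]; exact hp₀)
    rw [h2, ← pauli_single, pauliCoeff_pauli, if_pos rfl] at h3
    exact one_ne_zero h3
  exact ⟨Equiv.ofBijective σ (Finite.injective_iff_bijective.1 hσinj), f, hfinj, hf⟩

theorem evolve_tensor_onSite {T : Unitary n d} {u : Fin n → Matrix (ZMod d) (ZMod d) ℂ}
    (hu : ∀ i, u i ∈ Matrix.unitaryGroup (ZMod d) ℂ) (hT : (T : Op n d) = tensor u)
    (i : Fin n) (M : Matrix (ZMod d) (ZMod d) ℂ) :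
    evolve T (onSite i M) = onSite i ((u i)ᴴ * M * u i) := by
  rw [evolve, hT, conjTranspose_tensor, onSite, tensor_mul, tensor_mul, onSite]
  congr 1
  funext j
  by_cases hj : j = i
  · subst hj; simp
  · have : (u j)ᴴ * u j = 1 := Matrix.mem_unitaryGroup_iff'.1 (hu j)
    simp [hj, this]

/-- Such a `V` is a scalar; to be a generator it is viewed as a single-site unitary, which requires
a site to exist. -/
theorem mem_localSwapGroup_of_evolve_onSite (hn : 1 ≤ n) {V : Unitary n d}
    (hV : ∀ i M, evolve V (onSite i M) = onSite i M) : V ∈ localSwapGroup n d := by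
  have hVV : (V : Op n d) * (V : Op n d)ᴴ = 1 := Matrix.mem_unitaryGroup_iff.1 V.2
  have hcomm : ∀ i M, Commute (onSite i M) (V : Op n d) := fun i M => by
    have h := congrArg (fun A => (V : Op n d) * A) (hV i M)
    simp only [evolve, ← Matrix.mul_assoc, hVV, one_mul] at h
    exact h
  let i₀ : Fin n := ⟨0, hn⟩
  obtain ⟨u, hVu⟩ : ∃ u, (V : Op n d) = onSite i₀ u := exists_eq_onSite fun a k _ hak =>
    (forall_commute_onSite_iff k _).1 (hcomm k) a hak
  refine Subgroup.subset_closure (Or.inr ⟨i₀, u, ?_, hVu⟩)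
  rw [Matrix.mem_unitaryGroup_iff, Matrix.star_eq_conjTranspose]
  refine onSite_injective i₀ ?_
  rw [onSite_mul, ← conjTranspose_onSite, ← hVu, hVV, onSite_one]

theorem IsNonEntangling.mem_localSwapGroup (hn : 1 ≤ n) (hd : 2 ≤ d) {U : Unitary n d}
    (hU : IsNonEntangling U) : U ∈ localSwapGroup n d := by
  obtain ⟨σ, f, hfinj, hf⟩ := hU.exists_perm hd
  choose u hu hfu using fun i => exists_unitary_mul_eq (f i) (hfinj i)
  obtain ⟨T, hT, hTu⟩ := tensor_mem_localSwapGroup hu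
  have hP := permUnitary_mem_localSwapGroup (d := d) σ.symm
  have hV : U * permUnitary σ.symm * T ∈ localSwapGroup n d := by
    refine mem_localSwapGroup_of_evolve_onSite hn fun i M => ?_
    have huu : (u i)ᴴ * u i = 1 := Matrix.mem_unitaryGroup_iff'.1 (hu i)
    rw [evolve_mul, evolve_mul, hf, evolve_permUnitary_onSite, Equiv.symm_apply_apply,
      evolve_tensor_onSite hu hTu, Matrix.mul_assoc, hfu, ← Matrix.mul_assoc, huu, one_mul]
  rwa [Subgroup.mul_mem_cancel_right _ hT, Subgroup.mul_mem_cancel_right _ hP] at hV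

theorem isNonEntangling_iff_mem_localSwapGroup (hn : 1 ≤ n) (hd : 2 ≤ d) (U : Unitary n d) :
    IsNonEntangling U ↔ U ∈ localSwapGroup n d :=
  ⟨fun h => h.mem_localSwapGroup hn hd, isNonEntangling_of_mem_localSwapGroup⟩

end Structure

/-! ### The Pauli growth -/

section Growth

variable {n d : ℕ} [NeZero d]

/-- In Pauli coordinates the constraints cut out a closed bounded set, and the evolved weight is a
continuous function of the coefficients. -/
theorem isCompact_growthValues (U : Unitary n d) : IsCompact (growthValues U) := by
  let K : Set (PauliLabel n d → ℂ) :=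
    {c | ∑ a, ‖c a‖ ^ 2 = 1 ∧ ∑ a, (labelWeight a : ℝ) * ‖c a‖ ^ 2 = 1 ∧ c 0 = 0}
  let g : (PauliLabel n d → ℂ) → ℝ := fun c => avgWeight (evolve U (∑ a, c a • pauli a)) - 1
  have hK : IsCompact K := by
    refine Metric.isCompact_of_isClosed_isBounded ?_ ?_
    · refine (isClosed_eq (by fun_prop) (by fun_prop)).inter
        ((isClosed_eq (by fun_prop) (by fun_prop)).inter (isClosed_eq (by fun_prop) (by fun_prop)))
    · refine (Metric.isBounded_closedBall (x := 0) (r := 1)).subset fun c hc => ?_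
      rw [mem_closedBall_zero_iff, pi_norm_le_iff_of_nonneg zero_le_one]
      intro a
      have h1 : ‖c a‖ ^ 2 ≤ 1 := by
        rw [← hc.1]
        exact Finset.single_le_sum (f := fun a => ‖c a‖ ^ 2) (fun a _ => sq_nonneg _)
          (Finset.mem_univ a)
      exact (sq_le_one_iff₀ (norm_nonneg _)).1 h1
  have hg : Continuous g := by
    have hcoef : ∀ (c : PauliLabel n d → ℂ) b, pauliCoeff (evolve U (∑ a, c a • pauli a)) b =
        ∑ a, c a * pauliCoeff (evolve U (pauli a)) b := fun c b => by
      rw [← evolveAut_apply, map_sum, pauliCoeff_sum]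
      exact Finset.sum_congr rfl fun a _ => by
        rw [map_smul, pauliCoeff_smul, evolveAut_apply]
    simp only [g, avgWeight, hcoef]
    fun_prop
  have himage : growthValues U = g '' K := by
    ext x
    constructor
    · rintro ⟨O, hO, hW, htr, rfl⟩
      refine ⟨pauliCoeff O, ⟨(hsNorm_eq_one_iff O).1 hO, hW, (trace_eq_zero_iff O).1 htr⟩, ?_⟩
      simp only [g, sum_pauliCoeff_smul_pauli]
    · rintro ⟨c, ⟨h1, h2, h3⟩, rfl⟩
      refine ⟨∑ a, c a • pauli a, ?_, ?_, ?_, rfl⟩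
      · simpa only [hsNorm_eq_one_iff, pauliCoeff_sum_smul_pauli] using h1
      · simpa only [avgWeight, pauliCoeff_sum_smul_pauli] using h2
      · rw [trace_eq_zero_iff, pauliCoeff_sum_smul_pauli, h3]
  rw [himage]
  exact hK.image hg

theorem mem_growthValues_of_labelWeight_eq_one (U : Unitary n d) {a : PauliLabel n d}
    (ha : labelWeight a = 1) : avgWeight (evolve U (pauli a)) - 1 ∈ growthValues U := by
  refine ⟨pauli a, hsNorm_pauli a, ?_, trace_pauli fun h => ?_, rfl⟩
  · rw [avgWeight_pauli, ha, Nat.cast_one]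
  · rw [(labelWeight_eq_zero_iff a).2 h] at ha
    exact zero_ne_one ha

theorem growthValues_nonempty (hn : 1 ≤ n) (hd : 2 ≤ d) (U : Unitary n d) :
    (growthValues U).Nonempty := by
  have : Fact (1 < d) := ⟨hd⟩
  have hp : ((1, 0) : ZMod d × ZMod d) ≠ 0 := fun h => one_ne_zero (congrArg Prod.fst h)
  exact ⟨_, mem_growthValues_of_labelWeight_eq_one U (labelWeight_single ⟨0, hn⟩ hp)⟩

theorem isGreatest_pauliGrowth (hn : 1 ≤ n) (hd : 2 ≤ d) (U : Unitary n d) :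
    IsGreatest (growthValues U) (pauliGrowth U) :=
  (isCompact_growthValues U).isGreatest_sSup (growthValues_nonempty hn hd U)

theorem nonneg_of_mem_growthValues {U : Unitary n d} {g : ℝ} (hg : g ∈ growthValues U) :
    0 ≤ g := by
  obtain ⟨O, hO, -, htr, rfl⟩ := hg
  exact sub_nonneg.2 (one_le_avgWeight (by rw [hsNorm_evolve, hO]) (by rw [trace_evolve, htr]))

theorem pauliGrowth_eq_zero_iff (hn : 1 ≤ n) (hd : 2 ≤ d) (U : Unitary n d) :
    pauliGrowth U = 0 ↔ IsNonEntangling U := by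
  have hG := isGreatest_pauliGrowth hn hd U
  constructor
  · intro h a ha
    have hmem := mem_growthValues_of_labelWeight_eq_one U ha
    exact sub_eq_zero.1 (le_antisymm (h ▸ hG.2 hmem) (nonneg_of_mem_growthValues hmem))
  · intro hU
    obtain ⟨O, hO, hW, htr, hg⟩ := hG.1
    rw [hg, sub_eq_zero, avgWeight_eq_one_iff (by rw [hsNorm_evolve, hO])
      (by rw [trace_evolve, htr])]
    exact hU.isWeightOne_evolve ((avgWeight_eq_one_iff hO htr).1 hW)

/-- Evolution by `U₁` permutes the feasible operators, and evolution by `U₂` leaves the final weight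
unchanged. -/
theorem growthValues_mul_mul {U₁ U₂ : Unitary n d} (V : Unitary n d)
    (h₁ : U₁ ∈ localSwapGroup n d) (h₂ : U₂ ∈ localSwapGroup n d) :
    growthValues (U₁ * V * U₂) = growthValues V := by
  ext g
  constructor
  · rintro ⟨O, hO, hW, htr, rfl⟩
    refine ⟨evolve U₁ O, by rw [hsNorm_evolve, hO], ?_, by rw [trace_evolve, htr], ?_⟩
    · rw [avgWeight_evolve_of_mem_localSwapGroup h₁, hW]
    · rw [evolve_mul, evolve_mul, avgWeight_evolve_of_mem_localSwapGroup h₂]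
  · rintro ⟨O, hO, hW, htr, rfl⟩
    refine ⟨evolve U₁⁻¹ O, by rw [hsNorm_evolve, hO], ?_, by rw [trace_evolve, htr], ?_⟩
    · rw [avgWeight_evolve_of_mem_localSwapGroup (inv_mem h₁), hW]
    · rw [evolve_mul, evolve_mul, avgWeight_evolve_of_mem_localSwapGroup h₂, evolve_evolve_inv]

end Growth

end Qudit

end

theorem mainTheorem5 (n d : ℕ) [NeZero d] (hn : 1 ≤ n) (hd : 2 ≤ d) :
    -- the maximum that defines the Pauli growth exists
    (∀ U : Qudit.Unitary n d,
      IsGreatest (Qudit.growthValues U) (Qudit.pauliGrowth U)) ∧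
    -- nonnegativity
    (∀ U : Qudit.Unitary n d, 0 ≤ Qudit.pauliGrowth U) ∧
    -- faithfulness
    (∀ U : Qudit.Unitary n d, Qudit.pauliGrowth U = 0 ↔ Qudit.IsNonEntangling U) ∧
    -- the non-entangling unitaries are those generated by swaps and single-qudit unitaries
    (∀ U : Qudit.Unitary n d, Qudit.IsNonEntangling U ↔ U ∈ Qudit.localSwapGroup n d) ∧
    -- invariance
    (∀ V U₁ U₂ : Qudit.Unitary n d, Qudit.IsNonEntangling U₁ → Qudit.IsNonEntangling U₂ →
      Qudit.pauliGrowth (U₁ * V * U₂) = Qudit.pauliGrowth V) := by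
  refine ⟨Qudit.isGreatest_pauliGrowth hn hd,
    fun U => Qudit.nonneg_of_mem_growthValues (Qudit.isGreatest_pauliGrowth hn hd U).1,
    Qudit.pauliGrowth_eq_zero_iff hn hd, Qudit.isNonEntangling_iff_mem_localSwapGroup hn hd, ?_⟩
  intro V U₁ U₂ h₁ h₂
  rw [Qudit.pauliGrowth, Qudit.pauliGrowth,
    Qudit.growthValues_mul_mul V (h₁.mem_localSwapGroup hn hd) (h₂.mem_localSwapGroup hn hd)]
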